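/- Let Alice's and Bob's Hilbert spaces be graded by local particle number, $\mathcal H^A=\bigoplus_{n\ge0}\mathcal H^A_n$ and $\mathcal H^B=\bigoplus_{m\ge0}\mathcal H^B_m$, with every $\mathcal H^A_n$, $\mathcal H^B_m$ finite-dimensional. Fix $N\ge 0$ and let $\phi$ and $\psi_i$ ($i$ in a finite set) be unit vectors with total particle number $N$, so that $\phi=\phi^0\oplus\dots\oplus\phi^N$ and $\psi_i=\psi_i^0\oplus\dots\oplus\psi_i^N$ with $\phi^n,\psi_i^n\in\mathcal H^A_n\otimes\mathcal H^B_{N-n}$. Let $p_i\ge0$ with $\sum_ip_i=1$. Let $\lambda^n$ and $\mu_i^n$ be the decreasingly ordered vectors of Schmidt coefficients (squared Schmidt amplitudes, i.e. eigenvalues of the reduced operator on $\mathcal H^A_n$, zeros included) of the unnormalised vectors $\phi^n$ and $\psi_i^n$. An LOCC conversion $\phi\to\{(p_i,\psi_i)\}$ is a finite adaptive protocol in which, in each round, Alice or Bob performs a generalised measurement on their own system, with finitely many Kraus operators $M_j$, $\sum_jM_j^\dagger M_j=1$, and communicates the result; every final branch is assigned to an outcome $i$, the (unnormalised) final vector of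 each branch assigned to $i$ is a multiple of $\psi_i$, and the total probability of the branches assigned to $i$ is $p_i$. The conversion is SSR-compatible if all Kraus operators commute with the local particle number operator, i.e. are block-diagonal, $M=\bigoplus_nM^n$. For decreasing $v,w\in\mathbb R^d$, $v\prec w$ means $\sum_{k\le e}v_k\le\sum_{k\le e}w_k$ for all $1\le e<d$, with equality for $e=d$. Then the following are equivalent: 1. there is an SSR-compatible LOCC conversion $\phi\to\{(p_i,\psi_i)\}$; 2. $\lambda^n\prec\sum_ip_i\,\mu_i^n$ for every $n=0,\dots,N$; 3. for every $n=0,\dots,N$ with $\phi^n\ne0$ there is an LOCC conversion (without superselection rule, on $\mathcal H^A_n\otimes\mathcal H^B_{N-n}$) $\hat\phi^n\to\{(p_i'^{\,n},\hat\psi_i^n)\}$, where $p_i'^{\,n}=p_i\,\|\psi_i^n\|^2/\|\phi^n\|^2$ and a hat denotes normalisation (if $\psi_i^n=0$, then $p_i'^{\,n}=0$ and outcome $i$ does not occur). -/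

import Mathlib

open scoped BigOperators Matrix

noncomputable section

namespace SSR

/-! ### Adaptive local protocols -/

/-- A finite adaptive LOCC protocol. `R` and `S` are the algebras of admissible local operators of
Alice and Bob. In each round one party performs a generalized measurement, given by Kraus operators
satisfying the completeness relation `∑ j, M_j† M_j = 1`, and announces the outcome `j`; everything
that follows may depend on it. A finished branch is declared to be outcome `i`. -/
inductive Protocol (R S : Type*) [Ring R] [StarRing R] [Ring S] [StarRing S] (ι : Type*)
  | done (i : ι) : Protocol R S ι
  | alice (k : ℕ) (M : Fin k → R) (hM : ∑ j, star (M j) * M j = 1)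
      (next : Fin k → Protocol R S ι) : Protocol R S ι
  | bob (k : ℕ) (M : Fin k → S) (hM : ∑ j, star (M j) * M j = 1)
      (next : Fin k → Protocol R S ι) : Protocol R S ι

section Protocol

variable {R S : Type*} [Ring R] [StarRing R] [Ring S] [StarRing S] {ι V : Type*}

/-- Running the protocol on the (unnormalized) vector `χ`, every branch that is declared to be
outcome `i` ends in the pure state `ψ i`, i.e. in a scalar multiple of that vector. Here `actA` and
`actB` are the actions `M ↦ M ⊗ 1` and `M ↦ 1 ⊗ M` on the bipartite space `V`. -/
def Protocol.Yields [SMul ℂ V] (actA : R → V → V) (actB : S → V → V) (ψ : ι → V) :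
    Protocol R S ι → V → Prop
  | .done i, χ => ∃ c : ℂ, χ = c • ψ i
  | .alice k M _ next, χ => ∀ j : Fin k, (next j).Yields actA actB ψ (actA (M j) χ)
  | .bob k M _ next, χ => ∀ j : Fin k, (next j).Yields actA actB ψ (actB (M j) χ)

open Classical in
/-- Total probability of the branches declared to be outcome `i`; the probability of a branch
is the squared norm of its unnormalized final vector. -/
def Protocol.prob (actA : R → V → V) (actB : S → V → V) (normSq : V → ℝ) (i : ι) :
    Protocol R S ι → V → ℝ
  | .done i', χ => if i' = i then normSq χ else 0
  | .alice k M _ next, χ => ∑ j : Fin k, (next j).prob actA actB normSq i (actA (M j) χ)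
  | .bob k M _ next, χ => ∑ j : Fin k, (next j).prob actA actB normSq i (actB (M j) χ)

end Protocol

/-! ### Ordinary bipartite systems

Vectors of `ℂ^α ⊗ ℂ^β` are written as coefficient matrices `x = ∑ x a b |a⟩|b⟩`. -/

section Plain

variable {α β ι : Type*} [Fintype α] [DecidableEq α] [Fintype β] [DecidableEq β]

/-- `⟨x|x⟩`. -/
def normSq (x : Matrix α β ℂ) : ℝ := ∑ a, ∑ b, ‖x a b‖ ^ 2

/-- `x / √⟨x|x⟩` (and `0` for `x = 0`). -/
def normalize (x : Matrix α β ℂ) : Matrix α β ℂ := (((Real.sqrt (normSq x))⁻¹ : ℝ) : ℂ) • x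

/-- `(M ⊗ 1) x`. -/
def actA (M : Matrix α α ℂ) (x : Matrix α β ℂ) : Matrix α β ℂ := M * x

/-- `(1 ⊗ M) x`. -/
def actB (M : Matrix β β ℂ) (x : Matrix α β ℂ) : Matrix α β ℂ := x * Mᵀ

/-- The decreasingly ordered Schmidt coefficients of `x` (squares of the Schmidt amplitudes, so
that they sum up to `⟨x|x⟩`), padded with zeros to length `dim ℂ^α`: the eigenvalues of the
reduced operator `tr_B |x⟩⟨x| = x x†`. -/
def schmidtVector (x : Matrix α β ℂ) : Fin (Fintype.card α) → ℝ :=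
  (Matrix.isHermitian_mul_conjTranspose_self x).eigenvalues₀

/-- LOCC conversion `φ ⟶ {(p i, ψ i)}` without superselection rule. -/
def LOCCConverts (φ : Matrix α β ℂ) (p : ι → ℝ) (ψ : ι → Matrix α β ℂ) : Prop :=
  ∃ P : Protocol (Matrix α α ℂ) (Matrix β β ℂ) ι,
    P.Yields actA actB ψ φ ∧ ∀ i, P.prob actA actB normSq i φ = p i

end Plain

/-- Majorization `v ≺ w` of decreasingly ordered vectors: partial sums of `v` are bounded by those
of `w`, with equality for the full sums. -/
def MajorizedBy {d : ℕ} (v w : Fin d → ℝ) : Prop :=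
  (∀ k < d, ∑ j with j.val < k, v j ≤ ∑ j with j.val < k, w j) ∧ ∑ j, v j = ∑ j, w j

/-! ### Systems with particle number superselection rule

`A n` indexes an orthonormal basis of the `n`-particle space of Alice, so that her Hilbert space is
`⨁ n, ℂ^(A n)`; likewise `B m` for Bob. -/

/-- Local operators commuting with the local particle number operator, i.e. `O = ⨁ n, O n` with
`O n` acting on the `n`-particle space. -/
abbrev LocalOp (A : ℕ → Type*) := ∀ n, Matrix (A n) (A n) ℂ

/-- Vectors with total particle number `N`: `φ = φ⁰ ⊕ ⋯ ⊕ φᴺ`, where `φⁿ` lies in the tensor product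
of the `n`-particle space of Alice and the `(N - n)`-particle space of Bob. -/
abbrev State (A B : ℕ → Type*) (N : ℕ) := ∀ n : Fin (N + 1), Matrix (A n) (B (N - n)) ℂ

section Graded

variable {A B : ℕ → Type*} [∀ n, Fintype (A n)] [∀ n, DecidableEq (A n)]
  [∀ n, Fintype (B n)] [∀ n, DecidableEq (B n)] {N : ℕ} {ι : Type*}

/-- `⟨φ|φ⟩`. -/
def State.normSq (φ : State A B N) : ℝ := ∑ n, SSR.normSq (φ n)

/-- `(M ⊗ 1) φ` for `M = ⨁ n, M n`. -/
def State.actA (M : LocalOp A) (φ : State A B N) : State A B N := fun n => SSR.actA (M n) (φ n)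

/-- `(1 ⊗ M) φ` for `M = ⨁ m, M m`; on the component `φⁿ` Bob has `N - n` particles. -/
def State.actB (M : LocalOp B) (φ : State A B N) : State A B N :=
  fun n => SSR.actB (M (N - n)) (φ n)

/-- LOCC conversion `φ ⟶ {(p i, ψ i)}` in which all local operators respect the superselection
rule. -/
def SSRConverts (φ : State A B N) (p : ι → ℝ) (ψ : ι → State A B N) : Prop :=
  ∃ P : Protocol (LocalOp A) (LocalOp B) ι,
    P.Yields State.actA State.actB ψ φ ∧
      ∀ i, P.prob State.actA State.actB State.normSq i φ = p i

/-- The SSR-ordered Schmidt vector `(λ⁰, …, λᴺ)`: the ordered Schmidt coefficients of the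
unnormalized components `φⁿ`. -/
def ssrSchmidtVector (φ : State A B N) (n : Fin (N + 1)) : Fin (Fintype.card (A n)) → ℝ :=
  schmidtVector (φ n)

end Graded

end SSR

end

open scoped BigOperators Matrix

noncomputable section

namespace SSR

/-! ### Majorization and convex combinations of permutations -/

/-! The three conditions are linked in a cycle: superselected conversion, conversion in each sector,
majorization in each sector, superselected conversion. A block-diagonal protocol restricts to every
sector (`Protocol.exists_sector`); a branch ending in `c • ψ i` leaves `c • ψ i n` there, which
produces the weights `p i * normSq (ψ i n)`. Within a sector, the tail of the Schmidt vector is the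
squared distance to the vectors of Schmidt rank at most `k`. Local operators cannot raise that rank
and a complete measurement preserves total squared norm, so the tail does not increase on average.
This gives the partial-sum inequalities of majorization. Conversely, majorization writes each
sector's Schmidt vector as a mixture of rearranged target vectors (`exists_weights_of_majorizedBy`).
The mixture weights can be taken common to all sectors, so one block-diagonal measurement by Alice
followed by one block-diagonal unitary of Bob (`exists_kraus`, `exists_unitary_actB_eq`) produces
the same scalar in every sector. Relative amplitudes and phases between sectors therefore come out
right. -/

lemma sum_fin_filter_lt {d k : ℕ} (hk : k ≤ d) (g : ℕ → ℝ) :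
    ∑ j : Fin d with j.val < k, g j = ∑ j ∈ Finset.range k, g j := by
  rw [Finset.sum_filter, Fin.sum_univ_eq_sum_range (fun j => if j < k then g j else 0) d,
    ← Finset.sum_filter]
  congr 1
  ext j
  simp only [Finset.mem_filter, Finset.mem_range]
  omega

/-- Abel summation: the boundary term vanishes because the full sum does, and each remaining term is
a decrement of `c` times a partial sum of `g`. -/
lemma sum_mul_nonneg_of_antitone {d : ℕ} {c g : ℕ → ℝ} (hc : ∀ i j, i ≤ j → j < d → c j ≤ c i)
    (hg : ∀ k < d, 0 ≤ ∑ j ∈ Finset.range k, g j) (hd : ∑ j ∈ Finset.range d, g j = 0) :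
    0 ≤ ∑ j ∈ Finset.range d, c j * g j := by
  have := Finset.sum_range_by_parts c g d
  simp only [smul_eq_mul, hd, mul_zero, zero_sub] at this
  rw [this, ← Finset.sum_neg_distrib]
  refine Finset.sum_nonneg fun i hi => ?_
  rw [Finset.mem_range] at hi
  rw [← neg_mul]
  exact mul_nonneg (by linarith [hc i (i + 1) (by omega) (by omega)]) (hg _ (by omega))

lemma MajorizedBy.sum_mul_le {d : ℕ} {v w c : Fin d → ℝ} (h : MajorizedBy v w)
    (hc : Antitone c) : ∑ j, c j * v j ≤ ∑ j, c j * w j := by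
  let ext (f : Fin d → ℝ) : ℕ → ℝ := fun j => if hj : j < d then f ⟨j, hj⟩ else 0
  have hext (f : Fin d → ℝ) (j : Fin d) : ext f j = f j := by simp [ext]
  have key : 0 ≤ ∑ j ∈ Finset.range d, ext c j * ext (w - v) j := by
    refine sum_mul_nonneg_of_antitone ?_ ?_ ?_
    · intro i j hij hj
      have hi : i < d := by omega
      simpa [ext, hi, hj] using hc (show (⟨i, hi⟩ : Fin d) ≤ ⟨j, hj⟩ from hij)
    · intro k hk
      rw [← sum_fin_filter_lt hk.le]
      simp only [hext, Pi.sub_apply, Finset.sum_sub_distrib]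
      linarith [h.1 k hk]
    · rw [← Fin.sum_univ_eq_sum_range]
      simp only [hext, Pi.sub_apply, Finset.sum_sub_distrib]
      linarith [h.2]
  rw [← Fin.sum_univ_eq_sum_range (fun j => ext c j * ext (w - v) j)] at key
  simp only [hext, Pi.sub_apply, mul_sub, Finset.sum_sub_distrib] at key
  linarith

/-- A decreasing vector majorized by `w` is a convex combination of the rearrangements of `w`. -/
theorem MajorizedBy.mem_convexHull_perm {d : ℕ} {v w : Fin d → ℝ} (h : MajorizedBy v w)
    (hv : Antitone v) :
    v ∈ convexHull ℝ (Set.range fun σ : Equiv.Perm (Fin d) => w ∘ σ) := by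
  by_contra hmem
  -- A separating functional with coefficients `c` is contradicted by rearrangement: sorting `c`
  -- decreasingly by `τ` only raises its pairing with `v`, majorization then replaces `v` by `w`,
  -- and the result is the value of `f` at the hull point `w ∘ τ⁻¹`.
  obtain ⟨f, u, hfu, huv⟩ := geometric_hahn_banach_closed_point (convex_convexHull ℝ _)
    ((Set.finite_range _).isClosed_convexHull ℝ) hmem
  let c : Fin d → ℝ := fun j => f (Pi.single j 1)
  have hf (x : Fin d → ℝ) : f x = ∑ j, c j * x j := by
    conv_lhs => rw [← Finset.univ_sum_single x, map_sum]
    refine Finset.sum_congr rfl fun j _ => ?_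
    have : Pi.single j (x j) = x j • (Pi.single j 1 : Fin d → ℝ) := by
      rw [← Pi.single_smul, smul_eq_mul, mul_one]
    rw [this, map_smul, smul_eq_mul, mul_comm]
  let τ : Equiv.Perm (Fin d) := Tuple.sort (-c)
  have hτ : Antitone (c ∘ τ) := fun i j hij => by
    have := Tuple.monotone_sort (-c) hij
    simpa using this
  have h1 : ∑ j, c j * v j ≤ ∑ j, c (τ j) * v j := by
    have hmv : Monovary (c ∘ τ) v := hτ.monovary hv
    have := hmv.sum_comp_perm_mul_le_sum_mul (σ := τ⁻¹)
    simpa using this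
  have h2 : ∑ j, c (τ j) * v j ≤ ∑ j, c (τ j) * w j := h.sum_mul_le hτ
  have h3 : ∑ j, c (τ j) * w j = ∑ j, c j * w (τ⁻¹ j) := by
    rw [← Equiv.sum_comp τ fun j => c j * w (τ⁻¹ j)]
    simp
  have h4 := hfu (w ∘ ⇑τ⁻¹) (subset_convexHull ℝ _ ⟨τ⁻¹, rfl⟩)
  rw [hf] at h4 huv
  simp only [Function.comp_apply] at h4
  linarith

/-- Simultaneous version of `MajorizedBy.mem_convexHull_perm`, with common weights. -/
theorem exists_weights_of_majorizedBy {m : Type*} [Finite m] {d : m → ℕ} {v w : ∀ n, Fin (d n) → ℝ}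
    (h : ∀ n, MajorizedBy (v n) (w n)) (hv : ∀ n, Antitone (v n)) :
    ∃ (κ : Type) (_ : Fintype κ) (t : κ → ℝ) (σ : κ → ∀ n, Equiv.Perm (Fin (d n))),
      (∀ k, 0 ≤ t k) ∧ ∑ k, t k = 1 ∧ ∀ n b, v n b = ∑ k, t k * w n (σ k n b) := by
  have hmem : v ∈ Set.pi Set.univ fun n =>
      convexHull ℝ (Set.range fun σ : Equiv.Perm (Fin (d n)) => w n ∘ σ) :=
    fun n _ => (h n).mem_convexHull_perm (hv n)
  -- The product of convex hulls is the convex hull of the product; this makes the weights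
  -- independent of the sector.
  rw [← convexHull_pi, mem_convexHull_iff_exists_fintype] at hmem
  obtain ⟨κ, hκ, t, z, ht, ht1, hz, hsum⟩ := hmem
  choose σ hσ using fun k n => hz k n (Set.mem_univ n)
  refine ⟨κ, hκ, t, σ, ht, ht1, fun n b => ?_⟩
  rw [← hsum]
  simp only [Finset.sum_apply, Pi.smul_apply, smul_eq_mul]
  exact Finset.sum_congr rfl fun k _ => by rw [← hσ k n]; rfl

section SchmidtVector

open scoped ComplexOrder

variable {α β : Type*} [Fintype α] [Fintype β]

/-! ### Norms -/

lemma ofReal_normSq (x : Matrix α β ℂ) : ((normSq x : ℝ) : ℂ) = (x * xᴴ).trace := by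
  simp only [normSq, Matrix.trace, Matrix.diag_apply, Matrix.mul_apply, Matrix.conjTranspose_apply,
    Complex.ofReal_sum, Complex.ofReal_pow]
  simp [Complex.mul_conj']

lemma normSq_nonneg (x : Matrix α β ℂ) : 0 ≤ normSq x :=
  Finset.sum_nonneg fun _ _ => Finset.sum_nonneg fun _ _ => by positivity

lemma normSq_eq_zero {x : Matrix α β ℂ} : normSq x = 0 ↔ x = 0 := by
  rw [← Complex.ofReal_inj, ofReal_normSq, Complex.ofReal_zero,
    Matrix.trace_mul_conjTranspose_self_eq_zero_iff]

lemma normSq_smul (c : ℂ) (x : Matrix α β ℂ) : normSq (c • x) = ‖c‖ ^ 2 * normSq x := by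
  simp [normSq, Finset.mul_sum, mul_pow]

lemma normSq_normalize {x : Matrix α β ℂ} (hx : x ≠ 0) : normSq (normalize x) = 1 := by
  have h : 0 < normSq x := (normSq_nonneg x).lt_of_ne' (normSq_eq_zero.not.mpr hx)
  rw [normalize, normSq_smul, Complex.norm_real, norm_inv, Real.norm_of_nonneg (Real.sqrt_nonneg _),
    inv_pow, Real.sq_sqrt h.le, inv_mul_cancel₀ h.ne']

lemma sum_normSq_actB [DecidableEq β] {J : Type*} [Fintype J] {M : J → Matrix β β ℂ}
    (hM : ∑ j, star (M j) * M j = 1) (x : Matrix α β ℂ) :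
    ∑ j, normSq (actB (M j) x) = normSq x := by
  rw [← Complex.ofReal_inj, Complex.ofReal_sum]
  simp only [ofReal_normSq, actB]
  calc ∑ j, (x * (M j)ᵀ * (x * (M j)ᵀ)ᴴ).trace
      = ∑ j, (x * (star (M j) * M j)ᵀ * xᴴ).trace := by
        refine Finset.sum_congr rfl fun j _ => ?_
        rw [Matrix.conjTranspose_mul, Matrix.star_eq_conjTranspose, Matrix.transpose_mul]
        simp only [Matrix.mul_assoc]
        rfl
    _ = (x * xᴴ).trace := by
        rw [← Matrix.trace_sum, ← Matrix.sum_mul, ← Matrix.mul_sum, ← Matrix.transpose_sum, hM,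
          Matrix.transpose_one, Matrix.mul_one]

lemma diagonal_projection {m : Type*} [Fintype m] [DecidableEq m] {V : Matrix α (m) ℂ} (hV : Vᴴ * V = 1)
    (P : m → Prop) [DecidablePred P] :
    (V * Matrix.diagonal (fun l => if P l then (1 : ℂ) else 0) * Vᴴ)ᴴ =
        V * Matrix.diagonal (fun l => if P l then (1 : ℂ) else 0) * Vᴴ ∧
      (V * Matrix.diagonal (fun l => if P l then (1 : ℂ) else 0) * Vᴴ) *
        (V * Matrix.diagonal (fun l => if P l then (1 : ℂ) else 0) * Vᴴ) =
        V * Matrix.diagonal (fun l => if P l then (1 : ℂ) else 0) * Vᴴ := by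
  constructor
  · rw [Matrix.conjTranspose_mul, Matrix.conjTranspose_mul, Matrix.conjTranspose_conjTranspose,
      Matrix.diagonal_conjTranspose, Matrix.mul_assoc]
    congr 3
    ext l
    simp [apply_ite]
  · set D := Matrix.diagonal (fun l => if P l then (1 : ℂ) else 0)
    have hD : D * D = D := by simp [D, Matrix.diagonal_mul_diagonal]
    calc V * D * Vᴴ * (V * D * Vᴴ) = V * D * (Vᴴ * V) * D * Vᴴ := by
          simp only [Matrix.mul_assoc]
      _ = V * (D * D) * Vᴴ := by rw [hV, Matrix.mul_one, Matrix.mul_assoc V D D]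
      _ = _ := by rw [hD]

variable [DecidableEq α]

lemma sum_normSq_actA {J : Type*} [Fintype J] {M : J → Matrix α α ℂ}
    (hM : ∑ j, star (M j) * M j = 1) (x : Matrix α β ℂ) :
    ∑ j, normSq (actA (M j) x) = normSq x := by
  rw [← Complex.ofReal_inj, Complex.ofReal_sum]
  simp only [ofReal_normSq, actA]
  calc ∑ j, (M j * x * (M j * x)ᴴ).trace
      = ∑ j, (star (M j) * M j * (x * xᴴ)).trace := by
        refine Finset.sum_congr rfl fun j _ => ?_
        rw [Matrix.conjTranspose_mul, ← Matrix.mul_assoc, Matrix.trace_mul_comm,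
          Matrix.star_eq_conjTranspose]
        simp only [Matrix.mul_assoc]
    _ = (x * xᴴ).trace := by
        rw [← Matrix.trace_sum, ← Finset.sum_mul, hM, Matrix.one_mul]

lemma normSq_add_normSq_sub {Q : Matrix α α ℂ} (hQ : Qᴴ = Q) (hQQ : Q * Q = Q)
    (x : Matrix α β ℂ) : normSq (Q * x) + normSq (x - Q * x) = normSq x := by
  have h : ∑ j : Bool, star (cond j Q (1 - Q)) * cond j Q (1 - Q) = 1 := by
    simp [Matrix.star_eq_conjTranspose, hQ, hQQ, sub_mul, mul_sub]
  simpa [actA, Matrix.sub_mul] using sum_normSq_actA h x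

/-! ### The Schmidt decomposition -/

lemma schmidtVector_antitone (x : Matrix α β ℂ) : Antitone (schmidtVector x) :=
  Matrix.IsHermitian.eigenvalues₀_antitone _

lemma schmidtVector_nonneg (x : Matrix α β ℂ) (l) : 0 ≤ schmidtVector x l := by
  have h := (Matrix.posSemidef_self_mul_conjTranspose x).eigenvalues_nonneg
    ((Fintype.equivOfCardEq (Fintype.card_fin _)) l)
  simpa [Matrix.IsHermitian.eigenvalues, schmidtVector] using h

lemma exists_schmidtBasis (x : Matrix α β ℂ) :
    ∃ V : Matrix α (Fin (Fintype.card α)) ℂ, Vᴴ * V = 1 ∧ V * Vᴴ = 1 ∧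
      x * xᴴ = V * Matrix.diagonal (fun l => (schmidtVector x l : ℂ)) * Vᴴ := by
  let hx := Matrix.isHermitian_mul_conjTranspose_self x
  let e : Fin (Fintype.card α) ≃ α := Fintype.equivOfCardEq (Fintype.card_fin _)
  let U : Matrix α α ℂ := hx.eigenvectorUnitary
  have hU : Uᴴ * U = 1 := Unitary.coe_star_mul_self hx.eigenvectorUnitary
  have hU' : U * Uᴴ = 1 := Unitary.coe_mul_star_self hx.eigenvectorUnitary
  have hs : x * xᴴ = U * Matrix.diagonal (fun a => (hx.eigenvalues a : ℂ)) * Uᴴ := by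
    conv_lhs => rw [hx.spectral_theorem, Unitary.conjStarAlgAut_apply]
    rfl
  have hd : Matrix.diagonal (fun l => (schmidtVector x l : ℂ)) =
      (Matrix.diagonal (fun a => (hx.eigenvalues a : ℂ))).submatrix e e := by
    rw [Matrix.submatrix_diagonal_equiv]
    congr 1
    ext l
    simp [Matrix.IsHermitian.eigenvalues, schmidtVector, e]
  refine ⟨U.submatrix id e, ?_, ?_, ?_⟩
  · rw [Matrix.conjTranspose_submatrix, ← Matrix.submatrix_mul _ _ _ _ _ Function.bijective_id, hU,
      Matrix.submatrix_one_equiv]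
  · rw [Matrix.conjTranspose_submatrix, Matrix.submatrix_mul_equiv, hU', Matrix.submatrix_id_id]
  · rw [Matrix.conjTranspose_submatrix, hd, Matrix.submatrix_mul_equiv, Matrix.submatrix_mul_equiv,
      ← hs, Matrix.submatrix_id_id]

lemma sum_schmidtVector (x : Matrix α β ℂ) : ∑ l, schmidtVector x l = normSq x := by
  obtain ⟨V, hV, -, hx⟩ := exists_schmidtBasis x
  rw [← Complex.ofReal_inj, ofReal_normSq, hx, Matrix.trace_mul_comm, ← Matrix.mul_assoc, hV,
    Matrix.one_mul, Matrix.trace_diagonal, Complex.ofReal_sum]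

/-! ### Best approximation by vectors of bounded Schmidt rank -/

/-- A diagonal entry of a projection is the squared norm of its row, hence at least its own square.
-/
lemma re_diag_mem_Icc_of_idempotent {m : Type*} [Fintype m] {E : Matrix m m ℂ} (hE : Eᴴ = E)
    (hEE : E * E = E) (l : m) : (E l l).re ∈ Set.Icc (0 : ℝ) 1 := by
  have h : E l l = ((∑ j, ‖E l j‖ ^ 2 : ℝ) : ℂ) := by
    conv_lhs => rw [← hEE, Matrix.mul_apply]
    push_cast
    refine Finset.sum_congr rfl fun j _ => ?_
    have : E j l = star (E l j) := by rw [← Matrix.conjTranspose_apply, hE]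
    rw [this, ← Complex.mul_conj']
    rfl
  have h' : (E l l).re = ∑ j, ‖E l j‖ ^ 2 := by rw [h, Complex.ofReal_re]
  have h0 : 0 ≤ (E l l).re := h' ▸ Finset.sum_nonneg fun _ _ => by positivity
  have h1 : ‖E l l‖ ^ 2 ≤ (E l l).re :=
    h' ▸ Finset.single_le_sum (f := fun j => ‖E l j‖ ^ 2) (fun _ _ => by positivity)
      (Finset.mem_univ l)
  have h2 : (E l l).re ≤ ‖E l l‖ := Complex.re_le_norm _
  exact ⟨h0, by nlinarith⟩

lemma sum_mul_le_sum_of_antitone {d : ℕ} {v q : Fin d → ℝ} (hv : Antitone v) (hv0 : ∀ l, 0 ≤ v l)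
    (hq : ∀ l, q l ∈ Set.Icc (0 : ℝ) 1) {k : ℕ} (hk : ∑ l, q l ≤ k) :
    ∑ l, v l * q l ≤ ∑ l with l.val < k, v l := by
  by_cases hkd : k < d
  -- Threshold value: `v l - c` is nonnegative below index `k` and nonpositive from `k` on, so the
  -- indicator of the first `k` indices is optimal. Nonnegativity of `c` allows total weight below
  -- `k`.
  · let c := v ⟨k, hkd⟩
    have h1 : ∑ l, (v l - c) * q l ≤ ∑ l with l.val < k, (v l - c) := by
      rw [Finset.sum_filter]
      refine Finset.sum_le_sum fun l _ => ?_
      obtain ⟨h0, h1⟩ := hq l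
      split_ifs with hl
      · have : c ≤ v l := hv (Fin.le_def.mpr hl.le)
        nlinarith
      · have : v l ≤ c := hv (Fin.le_def.mpr (not_lt.mp hl))
        nlinarith
    have h2 : ∑ l : Fin d with l.val < k, c = k * c := by
      rw [sum_fin_filter_lt hkd.le fun _ => c]
      simp
    have h3 := mul_le_mul_of_nonneg_right hk (hv0 ⟨k, hkd⟩)
    rw [Finset.sum_sub_distrib, h2] at h1
    simp only [sub_mul, Finset.sum_sub_distrib, ← Finset.mul_sum] at h1
    linarith [mul_comm c (∑ l, q l)]
  · rw [Finset.filter_true_of_mem fun l _ => by omega]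
    exact Finset.sum_le_sum fun l _ => mul_le_of_le_one_right (hv0 l) (hq l).2

lemma normSq_mul_eq_sum {Q : Matrix α α ℂ} (hQ : Qᴴ = Q) (hQQ : Q * Q = Q) {x : Matrix α β ℂ}
    {V : Matrix α (Fin (Fintype.card α)) ℂ}
    (hx : x * xᴴ = V * Matrix.diagonal (fun l => (schmidtVector x l : ℂ)) * Vᴴ) :
    normSq (Q * x) = ∑ l, schmidtVector x l * ((Vᴴ * Q * V) l l).re := by
  have h : ((normSq (Q * x) : ℝ) : ℂ) =
      (Matrix.diagonal (fun l => (schmidtVector x l : ℂ)) * (Vᴴ * Q * V)).trace := by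
    calc ((normSq (Q * x) : ℝ) : ℂ) = (Q * (x * xᴴ) * Q).trace := by
          rw [ofReal_normSq, Matrix.conjTranspose_mul, hQ]
          simp only [Matrix.mul_assoc]
      _ = ((V * Matrix.diagonal (fun l => (schmidtVector x l : ℂ))) * (Vᴴ * Q)).trace := by
          rw [Matrix.trace_mul_comm, ← Matrix.mul_assoc, hQQ, Matrix.trace_mul_comm, hx]
          simp only [Matrix.mul_assoc]
      _ = _ := by
          rw [Matrix.mul_assoc V, Matrix.trace_mul_comm V]
          simp only [Matrix.mul_assoc]
  have h' := congrArg Complex.re h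
  rw [Complex.ofReal_re, Matrix.trace, Complex.re_sum] at h'
  rw [h']
  simp [Matrix.diagonal_mul]

/-- Ky Fan's principle: in the Schmidt basis the diagonal entries of `Q` are weights in `[0, 1]`
with sum `Q.trace`, so at best they select the `k` largest coefficients. -/
lemma normSq_mul_le {Q : Matrix α α ℂ} (hQ : Qᴴ = Q) (hQQ : Q * Q = Q) {k : ℕ}
    (hk : Q.trace.re ≤ k) (x : Matrix α β ℂ) :
    normSq (Q * x) ≤ ∑ l with l.val < k, schmidtVector x l := by
  obtain ⟨V, hV, hV', hx⟩ := exists_schmidtBasis x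
  rw [normSq_mul_eq_sum hQ hQQ hx]
  refine sum_mul_le_sum_of_antitone (schmidtVector_antitone x) (schmidtVector_nonneg x) ?_ ?_
  · refine re_diag_mem_Icc_of_idempotent ?_ ?_
    · simp only [Matrix.conjTranspose_mul, Matrix.conjTranspose_conjTranspose, hQ, Matrix.mul_assoc]
    · calc Vᴴ * Q * V * (Vᴴ * Q * V) = Vᴴ * Q * (V * Vᴴ) * Q * V := by
            simp only [Matrix.mul_assoc]
        _ = Vᴴ * (Q * Q) * V := by rw [hV', Matrix.mul_one, Matrix.mul_assoc Vᴴ Q Q]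
        _ = Vᴴ * Q * V := by rw [hQQ]
  · have : (Vᴴ * Q * V).trace = Q.trace := by
      rw [Matrix.mul_assoc, Matrix.trace_mul_comm, Matrix.mul_assoc, hV', Matrix.mul_one]
    rw [← this, Matrix.trace, Complex.re_sum] at hk
    exact hk

/-- The orthogonal projection onto the column space of `z`. -/
lemma exists_rangeProjection (z : Matrix α β ℂ) :
    ∃ Q : Matrix α α ℂ, Qᴴ = Q ∧ Q * Q = Q ∧ Q * z = z ∧ Q.trace.re ≤ z.rank := by
  obtain ⟨V, hV, hV', hz⟩ := exists_schmidtBasis z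
  set D := Matrix.diagonal (fun l => if schmidtVector z l ≠ 0 then (1 : ℂ) else 0) with hD
  set S := Matrix.diagonal (fun l => (schmidtVector z l : ℂ)) with hS
  obtain ⟨h1, h2⟩ := diagonal_projection hV fun l => schmidtVector z l ≠ 0
  refine ⟨V * D * Vᴴ, h1, h2, ?_, ?_⟩
  · have hDS : D * S = S := by
      rw [hD, hS, Matrix.diagonal_mul_diagonal]
      congr 1
      ext l
      split_ifs with h
      · simp
      · simp [not_not.mp h]
    have h0 : (1 - V * D * Vᴴ) * (z * zᴴ) = 0 := by
      calc (1 - V * D * Vᴴ) * (z * zᴴ) = V * S * Vᴴ - V * D * (Vᴴ * V) * S * Vᴴ := by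
            rw [hz, Matrix.sub_mul, Matrix.one_mul]
            simp only [Matrix.mul_assoc]
        _ = 0 := by rw [hV, Matrix.mul_one, Matrix.mul_assoc V D S, hDS, sub_self]
    rw [Matrix.mul_self_mul_conjTranspose_eq_zero, Matrix.sub_mul, Matrix.one_mul,
      sub_eq_zero] at h0
    exact h0.symm
  · have htr : (V * D * Vᴴ).trace = (Fintype.card {l // schmidtVector z l ≠ 0} : ℂ) := by
      rw [Matrix.trace_mul_comm, ← Matrix.mul_assoc, hV, Matrix.one_mul, hD, Matrix.trace_diagonal,
        Finset.sum_boole, Fintype.card_subtype]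
    have hrank : S.rank ≤ z.rank := by
      have : S = Vᴴ * ((z * zᴴ) * V) := by
        calc S = (Vᴴ * V) * S * (Vᴴ * V) := by rw [hV, Matrix.one_mul, Matrix.mul_one]
          _ = Vᴴ * ((V * S * Vᴴ) * V) := by simp only [Matrix.mul_assoc]
          _ = _ := by rw [hz]
      rw [this]
      refine (Matrix.rank_mul_le_right _ _).trans ((Matrix.rank_mul_le_left _ _).trans ?_)
      exact Matrix.rank_mul_le_left _ _
    rw [htr, Complex.natCast_re]
    rw [hS, Matrix.rank_diagonal] at hrank
    simp only [ne_eq, Complex.ofReal_eq_zero] at hrank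
    exact_mod_cast hrank

/-- The part of the squared norm that is not carried by the `k` largest Schmidt coefficients. -/
def schmidtTail (k : ℕ) (x : Matrix α β ℂ) : ℝ :=
  normSq x - ∑ l with l.val < k, schmidtVector x l

/-- Eckart–Young lower bound: the component of `x - z` orthogonal to the range of `z` is that of `x`
alone, and the projection onto this range captures at most the `k` largest coefficients. -/
lemma schmidtTail_le_normSq_sub {k : ℕ} (x : Matrix α β ℂ) {z : Matrix α β ℂ} (hz : z.rank ≤ k) :
    schmidtTail k x ≤ normSq (x - z) := by
  obtain ⟨Q, hQ, hQQ, hQz, htr⟩ := exists_rangeProjection z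
  have h1 := normSq_add_normSq_sub hQ hQQ (x - z)
  have h2 : x - z - Q * (x - z) = x - Q * x := by
    rw [Matrix.mul_sub, hQz]
    abel
  have h3 := normSq_add_normSq_sub hQ hQQ x
  have h4 := normSq_mul_le hQ hQQ (htr.trans (Nat.cast_le.mpr hz)) x
  rw [h2] at h1
  have h5 := normSq_nonneg (Q * (x - z))
  rw [schmidtTail]
  linarith

/-- The bound is attained by projecting onto the first `k` Schmidt vectors. -/
lemma exists_rank_le_normSq_sub_eq (k : ℕ) (x : Matrix α β ℂ) :
    ∃ z : Matrix α β ℂ, z.rank ≤ k ∧ normSq (x - z) = schmidtTail k x := by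
  obtain ⟨V, hV, hV', hx⟩ := exists_schmidtBasis x
  obtain ⟨h1, h2⟩ := diagonal_projection hV fun l => l.val < k
  set D := Matrix.diagonal (fun l : Fin (Fintype.card α) => if l.val < k then (1 : ℂ) else 0)
    with hD
  refine ⟨V * D * Vᴴ * x, ?_, ?_⟩
  · have hDk : D.rank ≤ k := by
      rw [hD, Matrix.rank_diagonal]
      have hinj : Function.Injective (fun l : {l : Fin (Fintype.card α) //
          (if l.val < k then (1 : ℂ) else 0) ≠ 0} => (⟨l.1.val, by
            by_contra h
            exact l.2 (if_neg h)⟩ : Fin k)) := by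
        intro a b hab
        simpa [Fin.ext_iff, Subtype.ext_iff] using hab
      simpa using Fintype.card_le_of_injective _ hinj
    refine (Matrix.rank_mul_le_left _ _).trans ((Matrix.rank_mul_le_left _ _).trans ?_)
    exact (Matrix.rank_mul_le_right _ _).trans hDk
  · have h3 := normSq_add_normSq_sub h1 h2 x
    have h4 : Vᴴ * (V * D * Vᴴ) * V = D := by
      calc Vᴴ * (V * D * Vᴴ) * V = (Vᴴ * V) * D * (Vᴴ * V) := by simp only [Matrix.mul_assoc]
        _ = D := by rw [hV, Matrix.one_mul, Matrix.mul_one]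
    have h5 := normSq_mul_eq_sum h1 h2 hx
    rw [h4] at h5
    have h6 : ∑ l, schmidtVector x l * (D l l).re = ∑ l with l.val < k, schmidtVector x l := by
      rw [Finset.sum_filter]
      refine Finset.sum_congr rfl fun l _ => ?_
      rw [hD, Matrix.diagonal_apply_eq]
      split_ifs <;> simp
    rw [schmidtTail]
    linarith

lemma schmidtTail_nonneg (k : ℕ) (x : Matrix α β ℂ) : 0 ≤ schmidtTail k x := by
  obtain ⟨z, -, hz⟩ := exists_rank_le_normSq_sub_eq k x
  exact hz ▸ normSq_nonneg _

lemma schmidtTail_le_normSq (k : ℕ) (x : Matrix α β ℂ) : schmidtTail k x ≤ normSq x :=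
  sub_le_self _ (Finset.sum_nonneg fun _ _ => schmidtVector_nonneg x _)

lemma rank_smul_le (c : ℂ) (z : Matrix α β ℂ) : (c • z).rank ≤ z.rank := by
  rw [← Matrix.one_mul z, ← Matrix.smul_mul]
  simpa using Matrix.rank_mul_le_right (c • (1 : Matrix α α ℂ)) z

lemma schmidtTail_smul (k : ℕ) (c : ℂ) (x : Matrix α β ℂ) :
    schmidtTail k (c • x) = ‖c‖ ^ 2 * schmidtTail k x := by
  have key (c : ℂ) (x : Matrix α β ℂ) : schmidtTail k (c • x) ≤ ‖c‖ ^ 2 * schmidtTail k x := by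
    obtain ⟨z, hzk, hz⟩ := exists_rank_le_normSq_sub_eq k x
    rw [← hz, ← normSq_smul, smul_sub]
    exact schmidtTail_le_normSq_sub _ ((rank_smul_le c z).trans hzk)
  refine le_antisymm (key c x) ?_
  by_cases hc : c = 0
  · simpa [hc] using schmidtTail_nonneg k (0 : Matrix α β ℂ)
  · have h := mul_le_mul_of_nonneg_left (key c⁻¹ (c • x)) (sq_nonneg ‖c‖)
    rwa [inv_smul_smul₀ hc, norm_inv, ← mul_assoc, ← mul_pow,
      mul_inv_cancel₀ (norm_ne_zero_iff.mpr hc), one_pow, one_mul] at h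

/-- A single best approximation `z` of `x` serves all outcomes: each `M j * z` still has rank at
most `k`, and completeness preserves the total squared error. -/
lemma sum_schmidtTail_actA_le {J : Type*} [Fintype J] {M : J → Matrix α α ℂ}
    (hM : ∑ j, star (M j) * M j = 1) (k : ℕ) (x : Matrix α β ℂ) :
    ∑ j, schmidtTail k (actA (M j) x) ≤ schmidtTail k x := by
  obtain ⟨z, hzk, hz⟩ := exists_rank_le_normSq_sub_eq k x
  rw [← hz, ← sum_normSq_actA hM (x - z)]
  refine Finset.sum_le_sum fun j _ => ?_
  rw [actA, actA, Matrix.mul_sub]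
  exact schmidtTail_le_normSq_sub _ ((Matrix.rank_mul_le_right _ _).trans hzk)

lemma sum_schmidtTail_actB_le [DecidableEq β] {J : Type*} [Fintype J] {M : J → Matrix β β ℂ}
    (hM : ∑ j, star (M j) * M j = 1) (k : ℕ) (x : Matrix α β ℂ) :
    ∑ j, schmidtTail k (actB (M j) x) ≤ schmidtTail k x := by
  obtain ⟨z, hzk, hz⟩ := exists_rank_le_normSq_sub_eq k x
  rw [← hz, ← sum_normSq_actB hM (x - z)]
  refine Finset.sum_le_sum fun j _ => ?_
  rw [actB, actB, Matrix.sub_mul]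
  exact schmidtTail_le_normSq_sub _ ((Matrix.rank_mul_le_left _ _).trans hzk)

end SchmidtVector

lemma actA_smul {α β : Type*} [Fintype α] (M : Matrix α α ℂ) (a : ℂ) (x : Matrix α β ℂ) :
    actA M (a • x) = a • actA M x := Matrix.mul_smul _ _ _

lemma actB_smul {α β : Type*} [Fintype β] (M : Matrix β β ℂ) (a : ℂ) (x : Matrix α β ℂ) :
    actB M (a • x) = a • actB M x := Matrix.smul_mul _ _ _

/-! ### Schmidt tails along ordinary LOCC protocols. -/

section Monotonicity

variable {α β ι : Type*} [Fintype α] [Fintype β]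

lemma sqrt_normSq_smul_normalize (x : Matrix α β ℂ) :
    (Real.sqrt (normSq x) : ℂ) • normalize x = x := by
  by_cases hx : x = 0
  · simp [hx, normalize]
  · have h : Real.sqrt (normSq x) ≠ 0 :=
      (Real.sqrt_pos.mpr ((normSq_nonneg x).lt_of_ne' (normSq_eq_zero.not.mpr hx))).ne'
    rw [normalize, smul_smul, ← Complex.ofReal_mul, mul_inv_cancel₀ h, Complex.ofReal_one, one_smul]

lemma normSq_normalize_le_one (x : Matrix α β ℂ) : normSq (normalize x) ≤ 1 := by
  by_cases hx : x = 0
  · simp [hx, normalize, normSq]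
  · exact (normSq_normalize hx).le

variable [DecidableEq α]

lemma normSq_mul_schmidtTail_normalize (k : ℕ) (x : Matrix α β ℂ) :
    normSq x * schmidtTail k (normalize x) = schmidtTail k x := by
  conv_rhs => rw [← sqrt_normSq_smul_normalize x, schmidtTail_smul, Complex.norm_real,
    Real.norm_of_nonneg (Real.sqrt_nonneg _), Real.sq_sqrt (normSq_nonneg x)]

variable [Fintype ι]

lemma majorizedBy_of_sum_schmidtTail_le {x : Matrix α β ℂ} {p : ι → ℝ} {y : ι → Matrix α β ℂ}
    (h : ∑ i, p i * normSq (y i) = normSq x)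
    (htail : ∀ k, ∑ i, p i * schmidtTail k (y i) ≤ schmidtTail k x) :
    MajorizedBy (schmidtVector x) (∑ i, p i • schmidtVector (y i)) := by
  constructor
  · intro k _
    have h1 := htail k
    simp only [schmidtTail, mul_sub, Finset.sum_sub_distrib, h] at h1
    simp only [Finset.sum_apply, Pi.smul_apply, smul_eq_mul]
    rw [Finset.sum_comm]
    simp only [← Finset.mul_sum]
    linarith
  · simp only [Finset.sum_apply, Pi.smul_apply, smul_eq_mul]
    rw [Finset.sum_comm]
    simp only [← Finset.mul_sum, sum_schmidtVector, h]

variable [DecidableEq β]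

lemma Protocol.sum_prob (P : Protocol (Matrix α α ℂ) (Matrix β β ℂ) ι) (χ : Matrix α β ℂ) :
    ∑ i, P.prob actA actB normSq i χ = normSq χ := by
  classical
  induction P generalizing χ with
  | done i => simp [Protocol.prob]
  | alice k M hM next ih =>
    simp only [Protocol.prob]
    rw [Finset.sum_comm]
    simp only [ih, sum_normSq_actA hM]
  | bob k M hM next ih =>
    simp only [Protocol.prob]
    rw [Finset.sum_comm]
    simp only [ih, sum_normSq_actB hM]

/-- The tail of the Schmidt vector does not increase on average under local operations. -/
lemma Protocol.sum_prob_mul_schmidtTail_le {ψ : ι → Matrix α β ℂ} (hψ : ∀ i, normSq (ψ i) ≤ 1)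
    (k : ℕ) (P : Protocol (Matrix α α ℂ) (Matrix β β ℂ) ι) {χ : Matrix α β ℂ}
    (h : P.Yields actA actB ψ χ) :
    ∑ i, P.prob actA actB normSq i χ * schmidtTail k (ψ i) ≤ schmidtTail k χ := by
  classical
  induction P generalizing χ with
  | done i =>
    obtain ⟨c, rfl⟩ := h
    simp only [Protocol.prob, ite_mul, zero_mul, Finset.sum_ite_eq, Finset.mem_univ, if_true,
      normSq_smul, schmidtTail_smul]
    -- At a leaf the norm of `ψ i` enters as an extra factor, so a bound by one suffices; this
    -- admits `normalize 0 = 0`.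
    have h1 := mul_nonneg (sq_nonneg ‖c‖) (schmidtTail_nonneg k (ψ i))
    nlinarith [hψ i]
  | alice n M hM next ih =>
    simp only [Protocol.prob, Finset.sum_mul]
    rw [Finset.sum_comm]
    exact (Finset.sum_le_sum fun j _ => ih j (h j)).trans (sum_schmidtTail_actA_le hM k χ)
  | bob n M hM next ih =>
    simp only [Protocol.prob, Finset.sum_mul]
    rw [Finset.sum_comm]
    exact (Finset.sum_le_sum fun j _ => ih j (h j)).trans (sum_schmidtTail_actB_le hM k χ)

lemma LOCCConverts.normSq_eq_and_sum_schmidtTail_le {x : Matrix α β ℂ} (hx : x ≠ 0) {p : ι → ℝ}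
    {y : ι → Matrix α β ℂ}
    (h : LOCCConverts (normalize x) (fun i => p i * normSq (y i) / normSq x)
      (fun i => normalize (y i))) :
    ∑ i, p i * normSq (y i) = normSq x ∧
      ∀ k, ∑ i, p i * schmidtTail k (y i) ≤ schmidtTail k x := by
  obtain ⟨P, hP, hprob⟩ := h
  have hpos : 0 < normSq x := (normSq_nonneg x).lt_of_ne' (normSq_eq_zero.not.mpr hx)
  constructor
  · have h1 := P.sum_prob (normalize x)
    simp only [hprob, normSq_normalize hx, ← Finset.sum_div] at h1
    rwa [div_eq_one_iff_eq hpos.ne'] at h1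
  · intro k
    have h1 := P.sum_prob_mul_schmidtTail_le (fun i => normSq_normalize_le_one (y i)) k hP
    simp only [hprob] at h1
    have h2 := mul_le_mul_of_nonneg_left h1 hpos.le
    rw [normSq_mul_schmidtTail_normalize, Finset.mul_sum] at h2
    refine h2.trans' (Finset.sum_le_sum fun i _ => le_of_eq ?_)
    rw [← normSq_mul_schmidtTail_normalize k (y i)]
    field_simp

end Monotonicity

/-! ### Restriction to sectors and the passage to majorization. -/

section Graded

lemma State.normSq_smul {A B : ℕ → Type*} [∀ n, Fintype (A n)] [∀ n, Fintype (B n)] {N : ℕ}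
    (c : ℂ) (φ : State A B N) : (c • φ).normSq = ‖c‖ ^ 2 * φ.normSq := by
  simp only [State.normSq, Pi.smul_apply, SSR.normSq_smul, Finset.mul_sum]

variable {A B : ℕ → Type*} [∀ n, Fintype (A n)] [∀ n, DecidableEq (A n)]
  [∀ n, Fintype (B n)] [∀ n, DecidableEq (B n)] {N : ℕ} {ι : Type*}

/-- A protocol obeying the superselection rule acts on each sector as an ordinary protocol. -/
lemma Protocol.exists_sector (n : Fin (N + 1)) {ψ : ι → State A B N} (hψ : ∀ i, (ψ i).normSq = 1)
    (a : ℂ) (P : Protocol (LocalOp A) (LocalOp B) ι) :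
    ∃ P' : Protocol (Matrix (A n) (A n) ℂ) (Matrix (B (N - n)) (B (N - n)) ℂ) ι,
      ∀ χ : State A B N, P.Yields State.actA State.actB ψ χ →
        P'.Yields actA actB (fun i => normalize (ψ i n)) (a • χ n) ∧
        ∀ i, P'.prob actA actB normSq i (a • χ n) =
          ‖a‖ ^ 2 * (P.prob State.actA State.actB State.normSq i χ * normSq (ψ i n)) := by
  induction P with
  | done i =>
    refine ⟨.done i, fun χ h => ?_⟩
    obtain ⟨c, rfl⟩ := h
    constructor
    · refine ⟨a * c * (Real.sqrt (normSq (ψ i n)) : ℂ), ?_⟩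
      rw [mul_smul, sqrt_normSq_smul_normalize, mul_smul]
      rfl
    · intro i'
      simp only [Protocol.prob]
      split_ifs with hi
      · subst hi
        have h1 : (c • ψ i).normSq = ‖c‖ ^ 2 := by
          rw [State.normSq_smul, hψ, mul_one]
        rw [h1, Pi.smul_apply, normSq_smul, normSq_smul]
      · simp
  | alice k M hM next ih =>
    choose next' hnext' using ih
    refine ⟨.alice k (fun j => M j n) ?_ next', fun χ h => ?_⟩
    · simpa using congrFun hM n
    · refine ⟨fun j => ?_, fun i => ?_⟩
      · rw [actA_smul]
        exact (hnext' j _ (h j)).1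
      · simp only [Protocol.prob, actA_smul, Finset.sum_mul, Finset.mul_sum]
        exact Finset.sum_congr rfl fun j _ => (hnext' j _ (h j)).2 i
  | bob k M hM next ih =>
    choose next' hnext' using ih
    refine ⟨.bob k (fun j => M j (N - n)) ?_ next', fun χ h => ?_⟩
    · simpa using congrFun hM (N - n)
    · refine ⟨fun j => ?_, fun i => ?_⟩
      · rw [actB_smul]
        exact (hnext' j _ (h j)).1
      · simp only [Protocol.prob, actB_smul, Finset.sum_mul, Finset.mul_sum]
        exact Finset.sum_congr rfl fun j _ => (hnext' j _ (h j)).2 i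

/-- An empty sector is covered too: inverse and division by zero make the start vector and all
probabilities zero. -/
lemma SSRConverts.loccConverts {φ : State A B N} {p : ι → ℝ} {ψ : ι → State A B N}
    (hψ : ∀ i, (ψ i).normSq = 1) (h : SSRConverts φ p ψ) (n : Fin (N + 1)) :
    LOCCConverts (normalize (φ n)) (fun i => p i * normSq (ψ i n) / normSq (φ n))
      (fun i => normalize (ψ i n)) := by
  obtain ⟨P, hP, hprob⟩ := h
  obtain ⟨P', hP'⟩ := P.exists_sector n hψ (((Real.sqrt (normSq (φ n)))⁻¹ : ℝ) : ℂ)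
  refine ⟨P', (hP' φ hP).1, fun i => ?_⟩
  rw [normalize, (hP' φ hP).2 i, hprob i, Complex.norm_real, norm_inv,
    Real.norm_of_nonneg (Real.sqrt_nonneg _), inv_pow, Real.sq_sqrt (normSq_nonneg _)]
  ring

lemma majorizedBy_of_loccConverts [Fintype ι] {φ : State A B N} (hφ : φ.normSq = 1) {p : ι → ℝ}
    (hp : ∀ i, 0 ≤ p i) (hp1 : ∑ i, p i = 1) {ψ : ι → State A B N} (hψ : ∀ i, (ψ i).normSq = 1)
    (h : ∀ n, φ n ≠ 0 → LOCCConverts (normalize (φ n))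
      (fun i => p i * normSq (ψ i n) / normSq (φ n)) (fun i => normalize (ψ i n)))
    (n : Fin (N + 1)) :
    MajorizedBy (ssrSchmidtVector φ n) (∑ i, p i • ssrSchmidtVector (ψ i) n) := by
  -- An empty sector carries no LOCC hypothesis, so only an inequality of weights is available
  -- there. Both sides sum to one over the sectors, which forces equality in each; where `φ n = 0`,
  -- the weighted target components therefore vanish.
  have hle (m : Fin (N + 1)) : normSq (φ m) ≤ ∑ i, p i * normSq (ψ i m) := by
    by_cases hm : φ m = 0
    · rw [normSq_eq_zero.mpr hm]
      exact Finset.sum_nonneg fun i _ => mul_nonneg (hp i) (normSq_nonneg _)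
    · exact ((h m hm).normSq_eq_and_sum_schmidtTail_le hm).1.ge
  have htotal : ∑ m, normSq (φ m) = ∑ m, ∑ i, p i * normSq (ψ i m) := by
    rw [Finset.sum_comm]
    simp only [← Finset.mul_sum]
    have (i : ι) : ∑ m, normSq (ψ i m) = 1 := hψ i
    simp only [this, mul_one, hp1]
    exact hφ
  have heq := (Finset.sum_eq_sum_iff_of_le fun m _ => hle m).mp htotal n (Finset.mem_univ n)
  refine majorizedBy_of_sum_schmidtTail_le heq.symm fun k => ?_
  by_cases hn : φ n = 0
  · rw [normSq_eq_zero.mpr hn] at heq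
    calc ∑ i, p i * schmidtTail k (ψ i n) ≤ ∑ i, p i * normSq (ψ i n) :=
          Finset.sum_le_sum fun i _ => mul_le_mul_of_nonneg_left (schmidtTail_le_normSq _ _) (hp i)
      _ = 0 := heq.symm
      _ ≤ schmidtTail k (φ n) := schmidtTail_nonneg _ _
  · exact ((h n hn).normSq_eq_and_sum_schmidtTail_le hn).2 k

end Graded

/-! ### Construction of the protocol -/

/-- Two finite families with the same Gram matrix are related by an isometry. -/
lemma exists_linearIsometry_of_inner_eq {α E : Type*} [Fintype α] [NormedAddCommGroup E]
    [InnerProductSpace ℂ E] [FiniteDimensional ℂ E] {u v : α → E}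
    (h : ∀ a b, inner ℂ (u a) (u b) = inner ℂ (v a) (v b)) :
    ∃ L : E →ₗᵢ[ℂ] E, ∀ a, L (u a) = v a := by
  classical
  let X := Fintype.linearCombination ℂ u
  let Y := Fintype.linearCombination ℂ v
  have hnorm (c : α → ℂ) : ‖X c‖ = ‖Y c‖ := by
    have : inner ℂ (X c) (X c) = inner ℂ (Y c) (Y c) := by
      simp only [X, Y, Fintype.linearCombination_apply, sum_inner, inner_sum, inner_smul_left,
        inner_smul_right, h]
    rw [@norm_eq_sqrt_re_inner ℂ, @norm_eq_sqrt_re_inner ℂ, this]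
  -- Equal norms let `Y` factor through the range of `X` as an isometry, which finite dimension
  -- extends to all of `E`.
  have hker : LinearMap.ker X ≤ LinearMap.ker Y := fun c hc => by
    rw [LinearMap.mem_ker] at hc ⊢
    rw [← norm_eq_zero, ← hnorm, hc, norm_zero]
  let L₀ : LinearMap.range X →ₗ[ℂ] E :=
    (LinearMap.ker X).liftQ Y hker ∘ₗ X.quotKerEquivRange.symm.toLinearMap
  have hL₀ (c : α → ℂ) : L₀ ⟨X c, LinearMap.mem_range_self X c⟩ = Y c := by
    simp only [L₀, LinearMap.comp_apply, LinearEquiv.coe_coe]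
    rw [LinearMap.quotKerEquivRange_symm_apply_image, Submodule.mkQ_apply, Submodule.liftQ_apply]
  let L : LinearMap.range X →ₗᵢ[ℂ] E := ⟨L₀, by
    rintro ⟨_, c, rfl⟩
    rw [hL₀, ← hnorm]
    rfl⟩
  refine ⟨L.extend, fun a => ?_⟩
  have h1 := L.extend_apply ⟨X (Pi.single a 1), LinearMap.mem_range_self X _⟩
  have h2 : L ⟨X (Pi.single a 1), LinearMap.mem_range_self X _⟩ = Y (Pi.single a 1) := hL₀ _
  rw [h2] at h1
  simpa [X, Y, Fintype.linearCombination_apply_single] using h1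

/-- Two vectors with the same reduced operator on Alice's side are related by a unitary of Bob. -/
lemma exists_unitary_actB_eq {α β : Type*} [Fintype α] [Fintype β] [DecidableEq β]
    {x y : Matrix α β ℂ} (h : x * xᴴ = y * yᴴ) :
    ∃ M : Matrix β β ℂ, star M * M = 1 ∧ actB M x = y := by
  have hinner (z : Matrix α β ℂ) (a b : α) :
      inner ℂ (WithLp.toLp 2 (fun j => star (z a j)) : EuclideanSpace ℂ β)
        (WithLp.toLp 2 (fun j => star (z b j))) = (z * zᴴ) a b := by
    simp [PiLp.inner_apply, Matrix.mul_apply, mul_comm]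
  obtain ⟨L, hL⟩ := exists_linearIsometry_of_inner_eq
    (u := fun a => (WithLp.toLp 2 (fun j => star (x a j)) : EuclideanSpace ℂ β))
    (v := fun a => (WithLp.toLp 2 (fun j => star (y a j)) : EuclideanSpace ℂ β))
    fun a b => by rw [hinner, hinner, h]
  let W : Matrix β β ℂ := Matrix.of fun i j => L (EuclideanSpace.single j 1) i
  have hW : Wᴴ * W = 1 := by
    ext i j
    have h1 := L.inner_map_map (EuclideanSpace.single i 1) (EuclideanSpace.single j 1)
    rw [EuclideanSpace.inner_single_left] at h1
    simp only [PiLp.inner_apply, RCLike.inner_apply, map_one, one_mul] at h1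
    simp only [Matrix.mul_apply, Matrix.conjTranspose_apply, W, Matrix.of_apply, Matrix.one_apply]
    convert h1 using 1
    · exact Finset.sum_congr rfl fun _ _ => mul_comm _ _
    · simp [PiLp.single_apply]
  have hWx : W * xᴴ = yᴴ := by
    ext i a
    have h1 := congrArg (fun w : EuclideanSpace ℂ β => w i) (hL a)
    have h2 : (WithLp.toLp 2 (fun j => star (x a j)) : EuclideanSpace ℂ β) =
        ∑ j, star (x a j) • EuclideanSpace.single j (1 : ℂ) := by
      ext j
      simp [Pi.single_apply]
    simp only [h2, map_sum, map_smul] at h1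
    simp only [Matrix.mul_apply, Matrix.conjTranspose_apply, W, Matrix.of_apply]
    rw [← h1]
    simp [mul_comm]
  -- `actB` multiplies by the transpose, so this choice gives `x * Wᴴ`, the adjoint of `W * xᴴ =
  -- yᴴ`.
  refine ⟨(Wᴴ)ᵀ, ?_, ?_⟩
  · have : star (Wᴴ)ᵀ * (Wᴴ)ᵀ = (Wᴴ * W)ᵀ := by
      rw [Matrix.transpose_mul]
      congr 1
      ext i j
      simp
    rw [this, hW, Matrix.transpose_one]
  · rw [actB, Matrix.transpose_transpose, ← Matrix.conjTranspose_conjTranspose x,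
      ← Matrix.conjTranspose_mul, hWx, Matrix.conjTranspose_conjTranspose]

/-- A measurement of Alice steering `x`, up to a unitary of Bob, to `y j` with probability weight
`q j`. The outcome `none` has probability zero and completes the measurement. -/
lemma exists_kraus {α β J : Type*} [Fintype α] [DecidableEq α] [Fintype β] [Fintype J]
    (x : Matrix α β ℂ) (y : J → Matrix α β ℂ) {q : J → ℝ} (hq : ∀ j, 0 ≤ q j)
    (σ : J → Equiv.Perm (Fin (Fintype.card α)))
    (h : ∀ b, schmidtVector x b = ∑ j, q j * schmidtVector (y j) (σ j b)) :
    ∃ M : Option J → Matrix α α ℂ, ∑ o, star (M o) * M o = 1 ∧ actA (M none) x = 0 ∧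
      ∀ j, actA (M (some j)) x * (actA (M (some j)) x)ᴴ = (q j : ℂ) • (y j * (y j)ᴴ) := by
  obtain ⟨V, hV, hV', hx⟩ := exists_schmidtBasis x
  choose W hW _ hy using fun j => exists_schmidtBasis (y j)
  have hterm (j b) : 0 ≤ q j * schmidtVector (y j) (σ j b) :=
    mul_nonneg (hq j) (schmidtVector_nonneg _ _)
  -- Square root of the ratio of target to source coefficient. On the kernel of `x * xᴴ` division by
  -- zero gives `0`; the projection `K` fills that gap in the completeness relation.
  let s (j : J) (b : Fin (Fintype.card α)) : ℝ :=
    Real.sqrt (q j * schmidtVector (y j) (σ j b) / schmidtVector x b)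
  have hs (j b) : s j b * s j b = q j * schmidtVector (y j) (σ j b) / schmidtVector x b :=
    Real.mul_self_sqrt (div_nonneg (hterm j b) (schmidtVector_nonneg x b))
  let D (j : J) := Matrix.diagonal fun b => (s j b : ℂ)
  have hDH (j : J) : (D j)ᴴ = D j := by
    rw [Matrix.diagonal_conjTranspose]
    congr 1
    ext b
    simp
  let S := Matrix.diagonal fun b => (schmidtVector x b : ℂ)
  let R (j : J) := (D j).submatrix (σ j).symm id
  have hRR (j : J) : (R j)ᴴ * R j = D j * D j := by
    rw [Matrix.conjTranspose_submatrix, hDH, Matrix.submatrix_mul_equiv, Matrix.submatrix_id_id]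
  have hRSR (j : J) : R j * S * (R j)ᴴ =
      (q j : ℂ) • Matrix.diagonal fun b => (schmidtVector (y j) b : ℂ) := by
    have h1 : R j * S * (R j)ᴴ = (D j * S * D j).submatrix (σ j).symm (σ j).symm := by
      rw [Matrix.conjTranspose_submatrix, hDH,
        Matrix.submatrix_mul _ _ _ _ _ Function.bijective_id,
        Matrix.submatrix_mul _ _ _ _ _ Function.bijective_id, Matrix.submatrix_id_id]
    rw [h1, Matrix.diagonal_mul_diagonal, Matrix.diagonal_mul_diagonal,
      Matrix.submatrix_diagonal_equiv, ← Matrix.diagonal_smul]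
    congr 1
    ext b
    simp only [Function.comp_apply, Pi.smul_apply, smul_eq_mul]
    obtain ⟨b, rfl⟩ := (σ j).surjective b
    rw [Equiv.symm_apply_apply]
    norm_cast
    rw [mul_right_comm, hs]
    by_cases hb : schmidtVector x b = 0
    -- A vanishing coefficient of `x` is a sum of nonnegative terms, so every target term vanishes
    -- with it.
    · have h0 := (Finset.sum_eq_zero_iff_of_nonneg fun j _ => hterm j b).mp ((h b).symm.trans hb) j
        (Finset.mem_univ j)
      rw [h0, hb, zero_div, zero_mul]
    · rw [div_mul_cancel₀ _ hb]
  set K := Matrix.diagonal fun b => if schmidtVector x b = 0 then (1 : ℂ) else 0 with hK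
  obtain ⟨hP, hPP⟩ := diagonal_projection hV fun b => schmidtVector x b = 0
  -- `Vᴴ` passes to the Schmidt basis of `x`, `R j` rescales and permutes, and `W j` maps into the
  -- Schmidt basis of `y j`.
  refine ⟨fun o => o.elim (V * K * Vᴴ) fun j => W j * R j * Vᴴ, ?_, ?_, fun j => ?_⟩
  · have hsome (j : J) : star (W j * R j * Vᴴ) * (W j * R j * Vᴴ) = V * (D j * D j) * Vᴴ := by
      calc star (W j * R j * Vᴴ) * (W j * R j * Vᴴ)
          = V * ((R j)ᴴ * ((W j)ᴴ * W j) * R j) * Vᴴ := by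
            rw [Matrix.star_eq_conjTranspose]
            simp only [Matrix.conjTranspose_mul, Matrix.conjTranspose_conjTranspose,
              Matrix.mul_assoc]
        _ = V * (D j * D j) * Vᴴ := by rw [hW, Matrix.mul_one, hRR]
    rw [Fintype.sum_option]
    simp only [Option.elim, hsome]
    rw [Matrix.star_eq_conjTranspose, hP, hPP, ← Matrix.sum_mul, ← Matrix.mul_sum,
      ← Matrix.add_mul, ← Matrix.mul_add]
    suffices hone : K + ∑ j, D j * D j = 1 by rw [hone, Matrix.mul_one, hV']
    have hsum : ∑ j, D j * D j =
        Matrix.diagonal fun b => ((∑ j, s j b * s j b : ℝ) : ℂ) := by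
      ext a b
      rw [Matrix.sum_apply]
      by_cases hab : a = b
      · subst hab
        simp [D]
      · simp [D, hab]
    rw [hsum, hK, Matrix.diagonal_add, ← Matrix.diagonal_one]
    congr 1
    ext b
    simp only [hs, ← Finset.sum_div, ← h]
    split_ifs with hb
    · simp [hb]
    · simp [div_self hb]
  · have hKS : K * S = 0 := by
      rw [hK, Matrix.diagonal_mul_diagonal, ← Matrix.diagonal_zero]
      congr 1
      ext b
      split_ifs with hb <;> simp [hb]
    rw [← normSq_eq_zero]
    rw [← Complex.ofReal_inj, ofReal_normSq, Complex.ofReal_zero]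
    have : actA (V * K * Vᴴ) x * (actA (V * K * Vᴴ) x)ᴴ =
        V * K * (Vᴴ * V) * S * Vᴴ * (V * K * Vᴴ)ᴴ := by
      calc actA (V * K * Vᴴ) x * (actA (V * K * Vᴴ) x)ᴴ
          = V * K * Vᴴ * (x * xᴴ) * (V * K * Vᴴ)ᴴ := by
            rw [actA, Matrix.conjTranspose_mul (V * K * Vᴴ)]
            simp only [Matrix.mul_assoc]
        _ = _ := by
            rw [hx]
            simp only [Matrix.mul_assoc, S]
    simp only [Option.elim]
    rw [this, hV, Matrix.mul_one, Matrix.mul_assoc V K S, hKS]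
    simp
  · simp only [Option.elim]
    calc actA (W j * R j * Vᴴ) x * (actA (W j * R j * Vᴴ) x)ᴴ
        = W j * R j * Vᴴ * (x * xᴴ) * (V * (R j)ᴴ * (W j)ᴴ) := by
          rw [actA]
          simp only [Matrix.conjTranspose_mul, Matrix.conjTranspose_conjTranspose, Matrix.mul_assoc]
      _ = W j * (R j * (Vᴴ * V) * S * (Vᴴ * V) * (R j)ᴴ) * (W j)ᴴ := by
          rw [hx]
          simp only [Matrix.mul_assoc, S]
      _ = (q j : ℂ) • (y j * (y j)ᴴ) := by
          rw [hV, Matrix.mul_one, Matrix.mul_one, hRSR, hy, Matrix.mul_smul, Matrix.smul_mul]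

/-- A local operator needs a block for every particle number, while only the `N + 1` occurring ones
are prescribed. Injectivity of `f` prevents conflicting prescriptions, also for Bob's `n ↦ N - n`.
-/
lemma exists_pi_extension {ν : Type*} {C : ℕ → Type*} {P : ∀ m, C m → Prop} {f : ν → ℕ}
    (hf : Function.Injective f) (u : ∀ n, C (f n)) (hu : ∀ n, P _ (u n)) (hP : ∀ m, ∃ z, P m z) :
    ∃ z : ∀ m, C m, (∀ m, P m (z m)) ∧ ∀ n, z (f n) = u n := by
  have key (m : ℕ) : ∃ z : C m, P m z ∧ ∀ n (h : f n = m), z = h ▸ u n := by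
    by_cases hm : ∃ n, f n = m
    · obtain ⟨n, rfl⟩ := hm
      refine ⟨u n, hu n, fun n' h => ?_⟩
      obtain rfl := hf h
      rfl
    · obtain ⟨z, hz⟩ := hP m
      exact ⟨z, hz, fun n h => (hm ⟨n, h⟩).elim⟩
  choose z hz using key
  exact ⟨z, fun m => (hz m).1, fun n => (hz (f n)).2 n rfl⟩

theorem ssrConverts_of_majorizedBy {A B : ℕ → Type*} [∀ n, Fintype (A n)] [∀ n, DecidableEq (A n)]
    [∀ n, Fintype (B n)] [∀ n, DecidableEq (B n)] {N : ℕ} {ι : Type*} [Fintype ι]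
    {φ : State A B N} {p : ι → ℝ} (hp : ∀ i, 0 ≤ p i) (hp1 : ∑ i, p i = 1)
    {ψ : ι → State A B N} (hψ : ∀ i, (ψ i).normSq = 1)
    (h : ∀ n : Fin (N + 1),
      MajorizedBy (ssrSchmidtVector φ n) (∑ i, p i • ssrSchmidtVector (ψ i) n)) :
    SSRConverts φ p ψ := by
  classical
  obtain ⟨i₀⟩ : Nonempty ι := by
    by_contra hι
    rw [not_nonempty_iff] at hι
    simp at hp1
  obtain ⟨κ, _, t, σ, ht, ht1, hσ⟩ :=
    exists_weights_of_majorizedBy h fun n => schmidtVector_antitone (φ n)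
  -- Alice's outcomes are pairs of a target and a rearrangement, with a weight that does not depend
  -- on the sector.
  have hq (j : ι × κ) : 0 ≤ p j.1 * t j.2 := mul_nonneg (hp _) (ht _)
  have hdecomp (n : Fin (N + 1)) (b) : schmidtVector (φ n) b =
      ∑ j : ι × κ, (p j.1 * t j.2) * schmidtVector (ψ j.1 n) (σ j.2 n b) := by
    rw [Fintype.sum_prod_type_right]
    refine (hσ n b).trans (Finset.sum_congr rfl fun k _ => ?_)
    simp only [Finset.sum_apply, Pi.smul_apply, smul_eq_mul, Finset.mul_sum, ssrSchmidtVector]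
    exact Finset.sum_congr rfl fun i _ => by ring
  choose m hm1 hm0 hm using fun n : Fin (N + 1) =>
    exists_kraus (φ n) (fun j : ι × κ => ψ j.1 n) hq (fun j => σ j.2 n) (hdecomp n)
  obtain ⟨M, hM1, hM⟩ := exists_pi_extension (C := fun n => Option (ι × κ) → Matrix (A n) (A n) ℂ)
    (P := fun _ z => ∑ o, star (z o) * z o = 1) (f := fun n : Fin (N + 1) => n.val)
    Fin.val_injective m hm1 fun _ => ⟨fun o => o.elim 1 0, by simp⟩
  -- The completing outcome `none` has amplitude zero, so its label `i₀` is arbitrary.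
  let out (o : Option (ι × κ)) : ι := o.elim i₀ Prod.fst
  let c (o : Option (ι × κ)) : ℝ := o.elim 0 fun j => Real.sqrt (p j.1 * t j.2)
  have hgram (o : Option (ι × κ)) (n : Fin (N + 1)) :
      actA (m n o) (φ n) * (actA (m n o) (φ n))ᴴ =
        ((c o : ℂ) • ψ (out o) n) * ((c o : ℂ) • ψ (out o) n)ᴴ := by
    cases o with
    | none => simp [hm0, c]
    | some j =>
      rw [hm, Matrix.conjTranspose_smul, Matrix.smul_mul, Matrix.mul_smul, smul_smul]
      congr 1
      simp only [c, Option.elim, RCLike.star_def, Complex.conj_ofReal]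
      rw [← Complex.ofReal_mul, Real.mul_self_sqrt (hq j)]
  choose u hu1 hu using fun o n => exists_unitary_actB_eq (hgram o n)
  have hsub : Function.Injective fun n : Fin (N + 1) => N - n.val := fun a b hab => by
    ext
    simp only at hab
    omega
  choose U hU1 hU using fun o : Option (ι × κ) =>
    exists_pi_extension (C := fun n => Matrix (B n) (B n) ℂ) (P := fun _ z => star z * z = 1)
      hsub (u o) (hu1 o) fun _ => ⟨1, by simp⟩
  have hfinal (o : Option (ι × κ)) :
      State.actB (U o) (State.actA (fun n => M n o) φ) = (c o : ℂ) • ψ (out o) := by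
    funext n
    have h1 : M n o = m n o := congrFun (hM n) o
    have h2 : U o (N - n) = u o n := hU o n
    simp only [State.actA, State.actB, h1, h2, hu, Pi.smul_apply]
  let e := Fintype.equivFin (Option (ι × κ))
  refine ⟨.alice _ (fun j n => M n (e.symm j)) ?_ fun j =>
    .bob 1 (fun _ => U (e.symm j)) ?_ fun _ => .done (out (e.symm j)), ?_, fun i => ?_⟩
  · funext n
    rw [Finset.sum_apply]
    exact (Equiv.sum_comp e.symm fun o => star (M n o) * M n o).trans (hM1 n)
  · funext n
    simpa using hU1 (e.symm j) n
  · exact fun j _ => ⟨_, hfinal (e.symm j)⟩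
  · simp only [Protocol.prob, hfinal, Finset.univ_unique, Finset.sum_const, Finset.card_singleton,
      one_smul]
    have hnorm (o) : ((c o : ℂ) • ψ (out o)).normSq = c o ^ 2 := by
      rw [State.normSq_smul, hψ, mul_one, Complex.norm_real, Real.norm_eq_abs, sq_abs]
    simp only [hnorm]
    refine (Equiv.sum_comp e.symm fun o => if out o = i then c o ^ 2 else 0).trans ?_
    rw [Fintype.sum_option, Fintype.sum_prod_type_right]
    have hsq (i k) : Real.sqrt (p i * t k) ^ 2 = p i * t k := Real.sq_sqrt (hq (i, k))
    have hsum (k : κ) : ∑ i', (if i' = i then p i' * t k else 0) = p i * t k :=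
      (Fintype.sum_eq_single i fun _ hi => if_neg hi).trans (if_pos rfl)
    simp only [out, c, Option.elim, hsq, hsum, ← Finset.mul_sum, ht1]
    simp

end SSR

end

theorem theorem1 {A B : ℕ → Type*} [∀ n, Fintype (A n)] [∀ n, DecidableEq (A n)]
    [∀ n, Fintype (B n)] [∀ n, DecidableEq (B n)] {N : ℕ} {ι : Type*} [Fintype ι]
    (φ : SSR.State A B N) (hφ : φ.normSq = 1)
    (p : ι → ℝ) (hp : ∀ i, 0 ≤ p i) (hp1 : ∑ i, p i = 1)
    (ψ : ι → SSR.State A B N) (hψ : ∀ i, (ψ i).normSq = 1) :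
    (SSR.SSRConverts φ p ψ ↔
      ∀ n : Fin (N + 1), SSR.MajorizedBy (SSR.ssrSchmidtVector φ n)
        (∑ i, p i • SSR.ssrSchmidtVector (ψ i) n)) ∧
    (SSR.SSRConverts φ p ψ ↔
      ∀ n : Fin (N + 1), φ n ≠ 0 →
        SSR.LOCCConverts (SSR.normalize (φ n))
          (fun i => p i * SSR.normSq (ψ i n) / SSR.normSq (φ n))
          (fun i => SSR.normalize (ψ i n))) := by
  have hLOCC := fun h : SSR.SSRConverts φ p ψ => h.loccConverts hψ
  have hMaj := SSR.majorizedBy_of_loccConverts hφ hp hp1 hψ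
  have hSSR := SSR.ssrConverts_of_majorizedBy (φ := φ) hp hp1 hψ
  exact ⟨⟨fun h => hMaj fun n _ => hLOCC h n, hSSR⟩, fun h n _ => hLOCC h n, fun h => hSSR (hMaj h)⟩
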